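/- Let $(R,\mathfrak m,\mathbf k)$ be a Noetherian complete local normal domain of Krull dimension $d\ge 2$ and of equal characteristic, i.e. $\operatorname{char} R=\operatorname{char}\mathbf k$. Let $\mathfrak q_1,\dots,\mathfrak q_r$ ($r\ge 0$) be height-one prime ideals of $R$. Then there is a sequence $(\mathbf x_n)_{n\in\mathbb N}$ of nonzero elements of $R$ such that the principal ideals $\mathbf x_nR$ are pairwise distinct (so that they form an infinite set of nonzero principal ideals) and, for every $n$, $\mathbf x_n\notin\mathfrak q_1\cup\dots\cup\mathfrak q_r$ and the ring $R/\mathbf x_nR$ is reduced. -/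

import Mathlib

/-!
Let `D` be a nonzero derivation of `R`. If `R / f` is not reduced, normality provides a height-one
prime `P` with `f ∈ P` and `f` divisible by the square of a uniformizer of `R_P`, so `D f ∈ P`.
Choose `a` and `b` in the maximal ideal without common zero in codimension one and consider the
members `f = a - c b` of their pencil with `D c = 0`. The Wronskian `b D(a) - a D(b)` is the same
for all of them, and it lies in every `P` as above. It can be made nonzero by replacing `a` with
`a + b e`, and then only finitely many height-one primes contain it; each of these, like each prime
to be avoided, contains at most one member of a suitable sequence of `f`s.

In equal characteristic such a `D` exists: with a coefficient field `k`, the ring `R` is finite over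
a power series ring `A = k⟦x₁, …, x_d⟧`. If `Frac R / Frac A` is separable, `∂/∂x₁` extends to
`Frac R`; otherwise `Frac R` has a nonzero derivation over `Frac A`. As `R` is finite over `A`, a
common denominator turns either one into a derivation of `R`.
-/

/-! ### Primes of height at most one -/

section CodimensionOne

variable {R : Type*} [CommRing R]

theorem exists_mem_forall_notMem_of_two_le_height {I : Ideal R} (hI : 2 ≤ I.height)
    {S : Set (Ideal R)} (hS : S.Finite) (hSprime : ∀ P ∈ S, P.IsPrime)
    (hSheight : ∀ P ∈ S, P.height ≤ 1) : ∃ x ∈ I, ∀ P ∈ S, x ∉ P := by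
  by_contra! hcover
  have hsub : (I : Set R) ⊆ ⋃ P ∈ S, (P : Set R) := fun x hx => by simpa using hcover x hx
  obtain ⟨P, hP, hIP⟩ :=
    (Ideal.subset_union_prime_finite hS ⊤ ⊤ fun P hP _ _ => hSprime P hP).mp hsub
  exact absurd (hI.trans ((Ideal.height_mono hIP).trans (hSheight P hP))) (by decide)

variable [IsNoetherianRing R]

theorem exists_height_le_one_mem_of_not_isUnit {a : R} (ha : ¬IsUnit a) :
    ∃ P : Ideal R, P.IsPrime ∧ P.height ≤ 1 ∧ a ∈ P := by
  obtain ⟨P, hP⟩ := Ideal.nonempty_minimalPrimes (mt Ideal.span_singleton_eq_top.mp ha)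
  exact ⟨P, hP.1.1, Ideal.height_le_one_of_isPrincipal_of_mem_minimalPrimes _ P hP,
    (Ideal.span_singleton_le_iff_mem P).mp hP.1.2⟩

variable [IsDomain R]

theorem mem_minimalPrimes_span_singleton_of_height_le_one {P : Ideal R} [P.IsPrime]
    (hP : P.height ≤ 1) {a : R} (ha : a ≠ 0) (haP : a ∈ P) :
    P ∈ (Ideal.span {a}).minimalPrimes := by
  obtain ⟨Q, hQ, hQP⟩ := Ideal.exists_minimalPrimes_le
    ((Ideal.span_singleton_le_iff_mem P).mpr haP)
  have := hQ.1.1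
  have hQ0 : Q.height ≠ 0 := by
    rw [Ne, Ideal.height_eq_zero_iff_eq_bot]
    rintro rfl
    exact ha (by simpa using hQ.1.2)
  have hPQ : P.height ≤ Q.height := hP.trans (Order.one_le_iff_ne_zero.mpr hQ0)
  exact Ideal.eq_of_le_of_height_le Q hQP hPQ ▸ hQ

theorem finite_setOf_isPrime_height_le_one_mem {a : R} (ha : a ≠ 0) :
    {P : Ideal R | P.IsPrime ∧ P.height ≤ 1 ∧ a ∈ P}.Finite :=
  (Ideal.finite_minimalPrimes_of_isNoetherianRing R (Ideal.span {a})).subset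
    fun _ ⟨_, hP, haP⟩ => mem_minimalPrimes_span_singleton_of_height_le_one hP ha haP

end CodimensionOne

/-- `a` and `b` have no common zero in codimension one: no prime of height at most one contains
both. In a normal Noetherian domain this says that the divisors of `a` and `b` share no component;
the zero ideal is included among the primes, so `a` and `b` do not both vanish. -/
def CoprimeInCodimOne {R : Type*} [CommRing R] (a b : R) : Prop :=
  ∀ P : Ideal R, P.IsPrime → P.height ≤ 1 → a ∈ P → b ∉ P

namespace CoprimeInCodimOne

variable {R : Type*} [CommRing R] {a b : R}

theorem add_mul_left (hab : CoprimeInCodimOne a b) (e : R) : CoprimeInCodimOne (a + b * e) b :=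
  fun P hP hht haP hbP =>
    hab P hP hht ((P.add_mem_iff_left (P.mul_mem_right e hbP)).mp haP) hbP

theorem subsingleton_setOf_sub_mul_mem (hab : CoprimeInCodimOne a b) {P : Ideal R} [P.IsPrime]
    (hP : P.height ≤ 1) {ι : Type*} {c : ι → R}
    (hc : b ∉ P → Function.Injective fun i => Ideal.Quotient.mk P (c i)) :
    {i | a - c i * b ∈ P}.Subsingleton := by
  intro i hi j hj
  have hbP : b ∉ P := fun hbP =>
    hab P ‹_› hP ((P.sub_mem_iff_left (P.mul_mem_left (c i) hbP)).mp hi) hbP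
  have hdiff : (c i - c j) * b ∈ P := by
    have := P.sub_mem hj hi
    rwa [sub_sub_sub_cancel_left, ← sub_mul] at this
  exact hc hbP (Ideal.Quotient.eq.mpr ((Ideal.IsPrime.mem_or_mem ‹_› hdiff).resolve_right hbP))

variable [IsNoetherianRing R] {c : ℕ → R}

theorem injective_span_singleton_sub_mul (hab : CoprimeInCodimOne a b)
    (hc : ∀ P : Ideal R, P.IsPrime → b ∉ P → Function.Injective fun n => Ideal.Quotient.mk P (c n))
    (hunit : ∀ n, ¬IsUnit (a - c n * b)) :
    Function.Injective fun n => Ideal.span {a - c n * b} := by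
  intro m n hmn
  obtain ⟨P, hP, hht, hmP⟩ := exists_height_le_one_mem_of_not_isUnit (hunit m)
  refine hab.subsingleton_setOf_sub_mul_mem hht (hc P hP) hmP ?_
  rw [← Ideal.span_singleton_le_iff_mem] at hmP
  exact (Ideal.span_singleton_le_iff_mem P).mp (hmn.symm.le.trans hmP)

end CoprimeInCodimOne

theorem exists_mem_coprimeInCodimOne_of_two_le_height {R : Type*} [CommRing R] [IsDomain R]
    [IsNoetherianRing R] {I : Ideal R} (hI : 2 ≤ I.height) :
    ∃ a ∈ I, ∃ b ∈ I, b ≠ 0 ∧ CoprimeInCodimOne a b := by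
  obtain ⟨a, haI, ha⟩ := exists_mem_forall_notMem_of_two_le_height hI
    (Set.finite_singleton (⊥ : Ideal R)) (by simpa using Ideal.isPrime_bot) (by simp)
  have ha0 : a ≠ 0 := by simpa using ha
  obtain ⟨b, hbI, hb⟩ := exists_mem_forall_notMem_of_two_le_height hI
    ((finite_setOf_isPrime_height_le_one_mem ha0).insert ⊥)
    (by rintro P (rfl | hP); exacts [Ideal.isPrime_bot, hP.1])
    (by rintro P (rfl | hP); exacts [by simp, hP.2.1])
  exact ⟨a, haI, b, hbI, by simpa using hb ⊥ (Set.mem_insert _ _), fun P hP hht haP =>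
    hb P (Set.mem_insert_of_mem _ ⟨hP, hht, haP⟩)⟩

/-! ### Reducedness of principal quotients of normal domains -/

section Reduced

variable {R : Type*} [CommRing R] [IsNoetherianRing R] {f s : R} {P : Ideal R}

theorem exists_isPrime_mem_iff_dvd_mul_of_not_isReduced (h : ¬IsReduced (R ⧸ Ideal.span {f})) :
    ∃ (P : Ideal R) (s : R), P.IsPrime ∧ (∀ x, x ∈ P ↔ f ∣ s * x) ∧ s ∈ P := by
  have : Nontrivial (nilradical (R ⧸ Ideal.span {f})) := by
    rw [Submodule.nontrivial_iff_ne_bot]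
    exact mt nilradical_eq_bot_iff.mp h
  obtain ⟨Q, hQ⟩ := associatedPrimes.nonempty (R ⧸ Ideal.span {f})
    (nilradical (R ⧸ Ideal.span {f}))
  obtain ⟨hQprime, ⟨s', hs'⟩, hQs⟩ := isAssociatedPrime_iff.mp hQ
  obtain ⟨s, rfl⟩ := Ideal.Quotient.mk_surjective s'
  refine ⟨Q.comap (Ideal.Quotient.mk _), s, hQprime.comap _, fun x => ?_, ?_⟩
  · rw [Ideal.mem_comap, hQs, Submodule.mem_colon_singleton, Submodule.mem_bot,
      ← Ideal.mem_span_singleton, ← Ideal.Quotient.eq_zero_iff_mem, map_mul, mul_comm,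
      ← Subtype.coe_inj]
    rfl
  · obtain ⟨n, hn⟩ := mem_nilradical.mp hs'
    exact hQprime.mem_of_pow_mem n (hn ▸ Q.zero_mem)

variable [IsDomain R]

-- Otherwise the fraction `s / f` maps `P` into itself, hence is integral over `R`, so `f ∣ s`.
theorem exists_mul_eq_mul_of_mem_iff_dvd_mul [IsIntegrallyClosed R] (hf : f ≠ 0) [hP : P.IsPrime]
    (h : ∀ x, x ∈ P ↔ f ∣ s * x) : ∃ t ∈ P, ∃ u ∉ P, s * t = f * u := by
  by_contra! hstable
  let K := FractionRing R
  have hf' : algebraMap R K f ≠ 0 := by simpa using hf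
  have hfP : f ∈ P := (h f).mpr (dvd_mul_left f s)
  have hint : IsIntegral R (algebraMap R K s / algebraMap R K f) := by
    refine isIntegral_of_smul_mem_submodule (Submodule.map (Algebra.linearMap R K) P) ?_
      (Submodule.FG.map _ (IsNoetherian.noetherian P)) _ ?_
    · intro h0
      have hfmem : algebraMap R K f ∈ Submodule.map (Algebra.linearMap R K) P := ⟨f, hfP, rfl⟩
      rw [h0] at hfmem
      exact hf' (by simpa using hfmem)
    · rintro _ ⟨x, hx, rfl⟩
      obtain ⟨u, hu⟩ := (h x).mp hx
      refine ⟨u, by_contra fun huP => hstable x hx u huP hu, ?_⟩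
      have hu' : algebraMap R K s * algebraMap R K x = algebraMap R K f * algebraMap R K u := by
        simpa only [map_mul] using congrArg (algebraMap R K) hu
      rw [Algebra.linearMap_apply, Algebra.linearMap_apply, smul_eq_mul, div_mul_eq_mul_div,
        hu', mul_div_cancel_left₀ _ hf']
  obtain ⟨y, hy⟩ := IsIntegrallyClosed.algebraMap_eq_of_integral hint
  have hsy : s = f * y := IsFractionRing.injective R K <| by
    rw [map_mul, hy, mul_div_cancel₀ _ hf']
  exact hP.one_notMem ((h 1).mpr ⟨y, by rw [mul_one, hsy]⟩)

theorem height_le_one_of_mul_eq_mul (hf : f ≠ 0) [hP : P.IsPrime] (h : ∀ x ∈ P, f ∣ s * x)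
    {t u : R} (ht : t ∈ P) (hu : u ∉ P) (hst : s * t = f * u) : P.height ≤ 1 := by
  refine Ideal.height_le_one_of_isPrincipal_of_mem_minimalPrimes (Ideal.span {t}) P
    ⟨⟨hP, (Ideal.span_singleton_le_iff_mem P).mpr ht⟩, ?_⟩
  rintro Q ⟨hQ, htQ⟩ hQP x hx
  obtain ⟨y, hy⟩ := h x hx
  have hux : u * x = t * y := mul_left_cancel₀ hf (by linear_combination -x * hst + t * hy)
  have hmem : u * x ∈ Q := hux ▸ Q.mul_mem_right y ((Ideal.span_singleton_le_iff_mem Q).mp htQ)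
  exact (hQ.mem_or_mem hmem).resolve_left fun huQ => hu (hQP huQ)

-- In `R_P`, where `u` is a unit, `f` is `s * t` up to a unit, a product of two elements of `P`.
theorem derivation_apply_mem_of_mul_eq_mul {k R : Type*} [CommRing k] [CommRing R] [Algebra k R]
    (D : Derivation k R R) {P : Ideal R} [hP : P.IsPrime] {f s t u : R} (hf : f ∈ P) (hs : s ∈ P)
    (ht : t ∈ P) (hu : u ∉ P) (hst : s * t = f * u) : D f ∈ P := by
  have hD : u * D f = s * D t + t * D s - f * D u := by
    have := congrArg D hst
    simp only [Derivation.leibniz, smul_eq_mul] at this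
    linear_combination -this
  have hmem : u * D f ∈ P := hD ▸ P.sub_mem
    (P.add_mem (P.mul_mem_right _ hs) (P.mul_mem_right _ ht)) (P.mul_mem_right _ hf)
  exact (hP.mem_or_mem hmem).resolve_left hu

theorem isReduced_quotient_span_singleton_of_derivation [IsIntegrallyClosed R] {k : Type*}
    [CommRing k] [Algebra k R] (D : Derivation k R R) (hf : f ≠ 0)
    (h : ∀ P : Ideal R, P.IsPrime → P.height ≤ 1 → f ∈ P → D f ∉ P) :
    IsReduced (R ⧸ Ideal.span {f}) := by
  by_contra hred
  obtain ⟨P, s, hP, hPs, hs⟩ := exists_isPrime_mem_iff_dvd_mul_of_not_isReduced hred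
  obtain ⟨t, ht, u, hu, hst⟩ := exists_mul_eq_mul_of_mem_iff_dvd_mul hf hPs
  have hfP : f ∈ P := (hPs f).mpr (dvd_mul_left f s)
  exact h P hP (height_le_one_of_mul_eq_mul hf (fun x => (hPs x).mp) ht hu hst) hfP
    (derivation_apply_mem_of_mul_eq_mul D hfP hs ht hu hst)

end Reduced

/-! ### Pencils with constant coefficients -/

section Pencil

variable {k R : Type*} [CommRing k] [CommRing R] [Algebra k R] (D : Derivation k R R)

/-- The Wronskian `b D(a) - a D(b)` of `a` and `b` (with the sign opposite to that of
`Polynomial.wronskian`). It does not change when `a` is replaced by a member `a - c b` of the pencil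
with `D c = 0`, so its zeros control the singularities of all these members. -/
def derivationWronskian (a b : R) : R :=
  b * D a - a * D b

theorem derivationWronskian_sub_mul_of_apply_eq_zero {c : R} (hc : D c = 0) (a b : R) :
    derivationWronskian D (a - c * b) b = derivationWronskian D a b := by
  simp only [derivationWronskian, map_sub, Derivation.leibniz, smul_eq_mul, hc]
  ring

theorem derivationWronskian_add_mul (a b e : R) :
    derivationWronskian D (a + b * e) b = derivationWronskian D a b + b ^ 2 * D e := by
  simp only [derivationWronskian, map_add, Derivation.leibniz, smul_eq_mul]
  ring

theorem derivationWronskian_mem {P : Ideal R} {a : R} (ha : a ∈ P) (hDa : D a ∈ P) (b : R) :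
    derivationWronskian D a b ∈ P :=
  P.sub_mem (P.mul_mem_left b hDa) (P.mul_mem_right (D b) ha)

variable [IsDomain R] [IsNoetherianRing R]

variable {D} in
theorem exists_coprimeInCodimOne_derivationWronskian_ne_zero (hD : D ≠ 0) {I : Ideal R}
    (hI : 2 ≤ I.height) :
    ∃ a ∈ I, ∃ b ∈ I, CoprimeInCodimOne a b ∧ derivationWronskian D a b ≠ 0 := by
  obtain ⟨a, ha, b, hb, hb0, hab⟩ := exists_mem_coprimeInCodimOne_of_two_le_height hI
  obtain ⟨e, he⟩ := DFunLike.ne_iff.mp hD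
  by_cases hW : derivationWronskian D a b = 0
  · refine ⟨a + b * e, I.add_mem ha (I.mul_mem_right e hb), b, hb, hab.add_mul_left e, ?_⟩
    rw [derivationWronskian_add_mul, hW, zero_add]
    exact mul_ne_zero (pow_ne_zero 2 hb0) he
  · exact ⟨a, ha, b, hb, hab, hW⟩

theorem isReduced_quotient_span_singleton_of_derivationWronskian [IsIntegrallyClosed R] {f b : R}
    (hf : f ≠ 0)
    (h : ∀ P : Ideal R, P.IsPrime → P.height ≤ 1 → f ∈ P → derivationWronskian D f b ∉ P) :
    IsReduced (R ⧸ Ideal.span {f}) :=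
  isReduced_quotient_span_singleton_of_derivation D hf fun P hP hht hfP hDfP =>
    h P hP hht hfP (derivationWronskian_mem D hfP hDfP b)

variable {D} in
theorem CoprimeInCodimOne.exists_seq_isReduced_quotient_span_singleton [IsIntegrallyClosed R]
    {a b : R} (hab : CoprimeInCodimOne a b) (hW : derivationWronskian D a b ≠ 0) {c : ℕ → R}
    (hDc : ∀ n, D (c n) = 0)
    (hc : ∀ P : Ideal R, P.IsPrime → b ∉ P → Function.Injective fun n => Ideal.Quotient.mk P (c n))
    (hunit : ∀ n, ¬IsUnit (a - c n * b)) {S : Set (Ideal R)} (hS : S.Finite)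
    (hSprime : ∀ P ∈ S, P.IsPrime) (hSheight : ∀ P ∈ S, P.height ≤ 1) :
    ∃ x : ℕ → R, Function.Injective (fun n => Ideal.span {x n}) ∧
      ∀ n, x n ≠ 0 ∧ (∀ P ∈ S, x n ∉ P) ∧ IsReduced (R ⧸ Ideal.span {x n}) := by
  let f : ℕ → R := fun n => a - c n * b
  let T := S ∪ {P | P.IsPrime ∧ P.height ≤ 1 ∧ derivationWronskian D a b ∈ P}
  have hTsub : ∀ P ∈ T, {n | f n ∈ P}.Subsingleton := by
    rintro P (hP | ⟨hP, hht, -⟩)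
    · have := hSprime P hP
      exact hab.subsingleton_setOf_sub_mul_mem (hSheight P hP) (hc P this)
    · exact hab.subsingleton_setOf_sub_mul_mem hht (hc P hP)
  have hTfin : T.Finite := hS.union (finite_setOf_isPrime_height_le_one_mem hW)
  have hgood : (⋃ P ∈ T, {n | f n ∈ P})ᶜ.Infinite :=
    (hTfin.biUnion fun P hP => (hTsub P hP).finite).infinite_compl
  let g : ℕ ↪ _ := hgood.natEmbedding
  have hg : ∀ n, ∀ P ∈ T, f (g n) ∉ P := fun n => by simpa using (g n).2
  have hWf : ∀ n, derivationWronskian D (f n) b = derivationWronskian D a b := fun n =>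
    derivationWronskian_sub_mul_of_apply_eq_zero D (hDc n) a b
  have hf0 : ∀ n, f n ≠ 0 := fun n h0 => hW <| by
    rw [← hWf n, h0, derivationWronskian, map_zero, mul_zero, zero_mul, sub_zero]
  refine ⟨fun n => f (g n), (hab.injective_span_singleton_sub_mul hc hunit).comp
    (Subtype.val_injective.comp g.injective), fun n => ⟨hf0 _, fun P hP => hg n P (.inl hP), ?_⟩⟩
  refine isReduced_quotient_span_singleton_of_derivationWronskian D (b := b) (hf0 _) ?_
  exact fun P hP hht hfP hWP => hg n P (.inr ⟨hP, hht, hWf (g n) ▸ hWP⟩) hfP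

end Pencil

/-! ### Constants of a derivation -/

section Constants

open IsLocalRing

variable {R : Type*} [CommRing R] [IsLocalRing R]

theorem injective_mk_pow_of_mem_maximalIdeal {b : R} (hb : b ∈ maximalIdeal R) {P : Ideal R}
    [P.IsPrime] (hbP : b ∉ P) : Function.Injective fun n : ℕ => Ideal.Quotient.mk P (b ^ n) := by
  let π : R ⧸ P →+* ResidueField R :=
    Ideal.Quotient.factor (le_maximalIdeal (Ideal.IsPrime.ne_top ‹_›))
  have hunit : ¬IsUnit (Ideal.Quotient.mk P b) := fun h =>
    (h.map π).ne_zero ((residue_eq_zero_iff b).mpr hb)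
  simpa only [map_pow] using pow_injective_of_not_isUnit hunit
    (mt Ideal.Quotient.eq_zero_iff_mem.mp hbP)

theorem injective_mk_natCast_of_charZero_residueField [CharZero (ResidueField R)] (P : Ideal R)
    [P.IsPrime] : Function.Injective fun n : ℕ => Ideal.Quotient.mk P n := by
  let π : R ⧸ P →+* ResidueField R :=
    Ideal.Quotient.factor (le_maximalIdeal (Ideal.IsPrime.ne_top ‹_›))
  have := π.charZero
  simpa only [map_natCast] using Nat.cast_injective

theorem exists_derivation_constants_injective_mk
    (hchar : ringChar R = ringChar (ResidueField R)) {k : Type*} [CommRing k] [Algebra k R]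
    (D : Derivation k R R) {b : R} (hb : b ∈ maximalIdeal R) :
    ∃ c : ℕ → R, (∀ n, D (c n) = 0) ∧ ∀ P : Ideal R, P.IsPrime → b ∉ P →
      Function.Injective fun n => Ideal.Quotient.mk P (c n) := by
  rcases eq_or_ne (ringChar R) 0 with h0 | hp
  · have : CharP (ResidueField R) 0 := ringChar.of_eq (hchar ▸ h0)
    have : CharZero (ResidueField R) := CharP.charP_to_charZero _
    exact ⟨fun n => n, D.map_natCast, fun P _ _ => injective_mk_natCast_of_charZero_residueField P⟩
  · refine ⟨fun n => b ^ (ringChar R * n), fun n => ?_, fun P _ hbP => ?_⟩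
    · rw [D.leibniz_pow, mul_smul, ← Nat.cast_smul_eq_nsmul R, ringChar.Nat.cast_ringChar,
        zero_smul]
    · exact (injective_mk_pow_of_mem_maximalIdeal hb hbP).comp (mul_right_injective₀ hp)

end Constants

/-! ### Coefficient fields -/

section FormalSmoothness

open Algebra MvPolynomial

theorem cotangentComplex_mk_eq_zero_iff {R S ι : Type*} [CommRing R] [CommRing S] [Algebra R S]
    (P : Generators R S ι) (f : P.ker) :
    P.toExtension.cotangentComplex (.mk f) = 0 ↔ ∀ i, aeval P.val (pderiv i f.1) = 0 := by
  rw [← P.cotangentSpaceBasis.repr.map_eq_zero_iff, DFunLike.ext_iff]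
  exact forall_congr' fun i => Eq.congr_left (P.cotangentSpaceBasis_repr_one_tmul f.1 i)

-- A class in `H1Cotangent` is represented by one polynomial, which has finitely many variables.
theorem exists_finset_forall_mem_range_h1Cotangent_map {R S : Type*} [CommRing R] [CommRing S]
    [Algebra R S] (x : H1Cotangent R S) :
    ∃ s : Finset S, ∀ A : Subalgebra R S, (s : Set S) ⊆ A →
      x ∈ Set.range (H1Cotangent.map R R A S) := by
  let PS := Generators.self R S
  obtain ⟨x, hx⟩ := x
  obtain ⟨f, rfl⟩ := Extension.Cotangent.mk_surjective x
  have hdf := (cotangentComplex_mk_eq_zero_iff PS f).mp hx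
  refine ⟨MvPolynomial.vars f.1, fun A hA => ?_⟩
  let PA := Generators.self R A
  obtain ⟨g, hgf⟩ := exists_rename_eq_of_vars_subset_range f.1 ((↑) : A → S)
    Subtype.val_injective (hA.trans Subtype.range_coe.ge)
  have hval (h : MvPolynomial A R) :
      (aeval PA.val h : A) = aeval PS.val (rename ((↑) : A → S) h) := by
    rw [aeval_rename]
    exact (aeval_algebraMap_apply S PA.val h).symm
  have hg : g ∈ PA.ker := by
    rw [Generators.ker_eq_ker_aeval_val, RingHom.mem_ker]
    exact Subtype.ext ((hval g).trans (hgf ▸ PS.aeval_val_eq_zero f.2))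
  have hdg : PA.toExtension.cotangentComplex (.mk ⟨g, hg⟩) = 0 := by
    refine (cotangentComplex_mk_eq_zero_iff PA _).mpr fun i => Subtype.ext ?_
    rw [hval, ← pderiv_rename Subtype.val_injective]
    exact hgf ▸ hdf i
  have hhom : (Generators.defaultHom PA PS).toAlgHom g = rename ((↑) : A → S) g :=
    (DFunLike.congr_fun (rename_eq_aeval _) g).symm
  refine ⟨⟨.mk ⟨g, hg⟩, hdg⟩, Subtype.ext ?_⟩
  exact congrArg Extension.Cotangent.mk (Subtype.ext (hhom.trans hgf))

theorem formallySmooth_of_perfectField (K L : Type*) [Field K] [PerfectField K] [Field L]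
    [Algebra K L] : FormallySmooth K L where
  projective_kaehlerDifferential := inferInstance
  subsingleton_h1Cotangent := by
    refine subsingleton_of_forall_eq 0 fun x => ?_
    obtain ⟨s, hs⟩ := exists_finset_forall_mem_range_h1Cotangent_map x
    let E := IntermediateField.adjoin K (s : Set L)
    have : EssFiniteType K E := IntermediateField.essFiniteType_iff.mpr ⟨s, rfl⟩
    have : FormallySmooth K E.toSubalgebra := FormallySmooth.of_perfectField (L := E)
    obtain ⟨y, rfl⟩ := hs E.toSubalgebra (IntermediateField.subset_adjoin K _)
    rw [Subsingleton.elim y 0, map_zero]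

end FormalSmoothness

section CoefficientField

open IsLocalRing

variable {R : Type*} [CommRing R] [IsLocalRing R]

theorem exists_perfectField_nonempty_ringHom (hchar : ringChar R = ringChar (ResidueField R)) :
    ∃ (F : Type) (_ : Field F), PerfectField F ∧ Nonempty (F →+* R) := by
  rcases CharP.char_is_prime_or_zero (ResidueField R) (ringChar (ResidueField R)) with hp | h0
  · have : Fact (ringChar R).Prime := ⟨hchar ▸ hp⟩
    exact ⟨ZMod (ringChar R), inferInstance, inferInstance, ⟨ZMod.castHom dvd_rfl R⟩⟩
  · have : CharP (ResidueField R) 0 := ringChar.of_eq h0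
    have : CharZero (ResidueField R) := CharP.charP_to_charZero _
    obtain ⟨_⟩ := (EqualCharZero.nonempty_algebraRat_iff R).mpr fun I hI =>
      let π : R ⧸ I →+* ResidueField R := Ideal.Quotient.factor (le_maximalIdeal hI)
      π.charZero
    exact ⟨ℚ, inferInstance, inferInstance, ⟨algebraMap ℚ R⟩⟩

theorem exists_algHom_section_residue [IsAdicComplete (maximalIdeal R) R] (F : Type*) [Field F]
    [PerfectField F] [Algebra F R] :
    ∃ σ : ResidueField R →ₐ[F] R, ∀ a, residue R (σ a) = a := by
  have : Algebra.FormallySmooth F (ResidueField R) := formallySmooth_of_perfectField F _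
  obtain ⟨σ, hσ⟩ := Algebra.FormallySmooth.exists_mkₐ_comp_eq_of_isAdicComplete
    (I := maximalIdeal R) (AlgHom.id F (ResidueField R))
  exact ⟨σ, DFunLike.congr_fun hσ⟩

theorem exists_ringHom_section_residue [IsAdicComplete (maximalIdeal R) R]
    (hchar : ringChar R = ringChar (ResidueField R)) :
    ∃ σ : ResidueField R →+* R, ∀ a, residue R (σ a) = a := by
  obtain ⟨F, _, _, ⟨φ⟩⟩ := exists_perfectField_nonempty_ringHom hchar
  let _ : Algebra F R := φ.toAlgebra
  obtain ⟨σ, hσ⟩ := exists_algHom_section_residue (R := R) F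
  exact ⟨σ, hσ⟩

end CoefficientField

/-! ### Noether normalization of complete local rings -/

section Normalization

open IsLocalRing

theorem exists_algHom_mvPowerSeries_X_eq {ι k R : Type*} [Finite ι] [CommRing k] [CommRing R]
    [Algebra k R] {I : Ideal R} [IsAdicComplete I R] {x : ι → R} (hx : ∀ i, x i ∈ I) :
    ∃ φ : MvPowerSeries ι k →ₐ[k] R, ∀ i, φ (MvPowerSeries.X i) = x i := by
  let _ : UniformSpace k := ⊥
  let _ : WithIdeal R := ⟨I⟩
  have : DiscreteTopology k := ⟨rfl⟩
  have : ContinuousSMul k R := DiscreteTopology.instContinuousSMul k R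
  have hI : IsAdic I := rfl
  obtain ⟨_, _⟩ := hI.isAdicComplete_iff.mp inferInstance
  have hx : MvPowerSeries.HasEval x :=
    ⟨fun i => WithIdeal.isTopologicallyNilpotent_of_mem (hx i), by simp⟩
  exact ⟨MvPowerSeries.aeval hx, fun i => by
    rw [← MvPolynomial.coe_X, MvPowerSeries.aeval_coe, MvPolynomial.aeval_X]⟩

theorem isPrecomplete_of_finite {A : Type*} (M : Type*) [CommRing A] (I : Ideal A)
    [IsPrecomplete I A] [AddCommGroup M] [Module A M] [Module.Finite A M] : IsPrecomplete I M := by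
  refine AdicCompletion.of_surjective_iff.mp fun y => ?_
  obtain ⟨t, rfl⟩ := AdicCompletion.ofTensorProduct_surjective_of_finite I M y
  induction t with
  | zero => exact ⟨0, by simp⟩
  | add t u ht hu =>
    obtain ⟨⟨v, hv⟩, ⟨w, hw⟩⟩ := And.intro ht hu
    exact ⟨v + w, by simp only [map_add, hv, hw]⟩
  | tmul a m =>
    obtain ⟨a, rfl⟩ := AdicCompletion.of_surjective I A a
    refine ⟨a • m, ?_⟩
    rw [AdicCompletion.ofTensorProduct_tmul, map_smul]
    rfl

theorem map_idealOfVars_mvPowerSeries (ι k : Type*) [CommRing k] :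
    (MvPolynomial.idealOfVars ι k).map (algebraMap (MvPolynomial ι k) (MvPowerSeries ι k)) =
      Ideal.span (Set.range MvPowerSeries.X) := by
  rw [Ideal.map_span, ← Set.range_comp]
  exact congrArg (Ideal.span <| Set.range ·) (funext MvPolynomial.coe_X)

theorem ker_constantCoeff_eq_span_range_X (ι k : Type*) [Finite ι] [CommRing k] :
    RingHom.ker (MvPowerSeries.constantCoeff (σ := ι) (R := k)) =
      Ideal.span (Set.range MvPowerSeries.X) := by
  refine le_antisymm (fun f hf => ?_) (Ideal.span_le.mpr ?_)
  · let e := MvPowerSeries.toAdicCompletionAlgEquiv ι k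
    have htrunc : MvPowerSeries.truncTotal 1 f = 0 := by
      ext x
      rw [MvPowerSeries.coeff_truncTotal_eq_ite]
      split_ifs with hx
      · rw [(Finsupp.degree_eq_zero_iff x).mp (Nat.lt_one_iff.mp hx)]
        exact hf
      · rfl
    have hef : e f ∈ RingHom.ker
        (AdicCompletion.evalOneₐ (MvPolynomial.idealOfVars ι k)).toRingHom := by
      change Ideal.Quotient.factor (pow_one _).le
        (Ideal.Quotient.mk _ (MvPowerSeries.truncTotal 1 f)) = 0
      rw [htrunc, map_zero, map_zero]
    rw [AdicCompletion.ker_evalOneₐ_eq_map _ (MvPolynomial.idealOfVars_fg ι k),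
      ← e.toAlgHom.comp_algebraMap, ← Ideal.map_map, map_idealOfVars_mvPowerSeries] at hef
    obtain ⟨g, hg, hgf⟩ := (Ideal.mem_map_of_equiv e.toRingEquiv _).mp hef
    exact e.injective hgf ▸ hg
  · rintro _ ⟨i, rfl⟩
    exact MvPowerSeries.constantCoeff_X i

theorem maximalIdeal_mvPowerSeries_eq_span_range_X (ι k : Type*) [Finite ι] [Field k] :
    maximalIdeal (MvPowerSeries ι k) = Ideal.span (Set.range MvPowerSeries.X) := by
  rw [← ker_constantCoeff_eq_span_range_X]
  ext f
  rw [mem_maximalIdeal, mem_nonunits_iff, MvPowerSeries.isUnit_iff_constantCoeff,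
    isUnit_iff_ne_zero, not_not, RingHom.mem_ker]

theorem ringKrullDim_mvPowerSeries_le (ι k : Type*) [Finite ι] [Field k] :
    ringKrullDim (MvPowerSeries ι k) ≤ Nat.card ι := by
  refine (ringKrullDim_le_spanFinrank_maximalIdeal _).trans ?_
  rw [maximalIdeal_mvPowerSeries_eq_span_range_X]
  exact_mod_cast (Submodule.spanFinrank_span_le_ncard_of_finite (Set.finite_range _)).trans
    ((Nat.card_coe_set_eq _).symm.trans_le (Finite.card_range_le _))

theorem finite_of_finite_quotient_smul_top {A M : Type*} [CommRing A] (I : Ideal A)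
    [IsPrecomplete I A] [AddCommGroup M] [Module A M] [IsHausdorff I M]
    [Module.Finite A (M ⧸ (I • ⊤ : Submodule A M))] : Module.Finite A M := by
  obtain ⟨n, g, hg⟩ := Module.Finite.exists_fin' A (M ⧸ (I • ⊤ : Submodule A M))
  obtain ⟨f, hf⟩ := Module.projective_lifting_property _ g (Submodule.mkQ_surjective (I • ⊤))
  have : IsPrecomplete I (Fin n → A) := isPrecomplete_of_finite _ I
  exact .of_surjective f (surjective_of_mkQ_comp_surjective (I := I) (hf ▸ hg))

theorem finite_quotient_of_finite_quotient_radical {A R : Type*} [CommRing A] [CommRing R]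
    [IsNoetherianRing R] [Algebra A R] (J : Ideal R) [Module.Finite A (R ⧸ J.radical)] :
    Module.Finite A (R ⧸ J) := by
  refine Module.finite_of_surjective_of_ker_le_nilradical
    (Ideal.Quotient.factorₐ A J.le_radical) (Ideal.Quotient.factor_surjective J.le_radical) ?_
    (IsNoetherian.noetherian _)
  intro x hx
  obtain ⟨y, rfl⟩ := Ideal.Quotient.mk_surjective x
  obtain ⟨n, hn⟩ : y ∈ J.radical := Ideal.Quotient.eq_zero_iff_mem.mp hx
  exact ⟨n, (map_pow _ y n).symm.trans (Ideal.Quotient.eq_zero_iff_mem.mpr hn)⟩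

theorem radical_eq_maximalIdeal_of_mem_minimalPrimes {R : Type*} [CommRing R] [IsLocalRing R]
    {J : Ideal R} (hJ : maximalIdeal R ∈ J.minimalPrimes) : J.radical = maximalIdeal R := by
  refine le_antisymm (hJ.1.1.radical_le_iff.mpr hJ.1.2) ?_
  rw [Ideal.radical_eq_sInf]
  exact le_sInf fun P hP => hJ.2 ⟨hP.2, hP.1⟩ (le_maximalIdeal hP.2.ne_top)

theorem ringKrullDim_le_of_isIntegral (A R : Type*) [CommRing A] [CommRing R] [Algebra A R]
    [Algebra.IsIntegral A R] : ringKrullDim R ≤ ringKrullDim A :=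
  Order.krullDim_le_of_strictMono (PrimeSpectrum.comap (algebraMap A R)) fun _ _ =>
    Ideal.IsIntegral.comap_lt_comap

theorem injective_algebraMap_of_ringKrullDim_le {A R : Type*} [CommRing A] [IsDomain A]
    [CommRing R] [Algebra A R] [Algebra.IsIntegral A R] {n : ℕ} (hA : ringKrullDim A ≤ n)
    (hR : n ≤ ringKrullDim R) : Function.Injective (algebraMap A R) := by
  refine (injective_iff_map_eq_zero _).mpr fun f hf => by_contra fun hf0 => ?_
  have hdim : ringKrullDim R ≤ ringKrullDim (A ⧸ Ideal.span {f}) := by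
    let π := Ideal.Quotient.lift (Ideal.span {f}) (algebraMap A R) fun a ha => by
      obtain ⟨b, rfl⟩ := Ideal.mem_span_singleton.mp ha
      rw [map_mul, hf, zero_mul]
    let _ : Algebra (A ⧸ Ideal.span {f}) R := π.toAlgebra
    have : IsScalarTower A (A ⧸ Ideal.span {f}) R := .of_algebraMap_eq fun _ => rfl
    have : Algebra.IsIntegral (A ⧸ Ideal.span {f}) R := .tower_top A
    exact ringKrullDim_le_of_isIntegral _ R
  have hsucc : (n : WithBot ℕ∞) + 1 ≤ n := calc
    (n : WithBot ℕ∞) + 1 ≤ ringKrullDim (A ⧸ Ideal.span {f}) + 1 :=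
      add_le_add_left (hR.trans hdim) 1
    _ ≤ ringKrullDim A :=
      ringKrullDim_quotient_succ_le_of_nonZeroDivisor (mem_nonZeroDivisors_of_ne_zero hf0)
    _ ≤ n := hA
  exact absurd (by exact_mod_cast hsucc : n + 1 ≤ n) n.lt_irrefl

theorem finite_mvPowerSeries_of_maximalIdeal_mem_minimalPrimes {k R ι : Type*} [Finite ι]
    [CommRing k] [CommRing R] [IsLocalRing R] [IsNoetherianRing R]
    [IsHausdorff (maximalIdeal R) R] [Algebra k R] [Module.Finite k (ResidueField R)]
    (φ : MvPowerSeries ι k →ₐ[k] R)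
    (hφ : maximalIdeal R ∈ (Ideal.span (Set.range fun i => φ (.X i))).minimalPrimes) :
    φ.toRingHom.Finite := by
  let I : Ideal (MvPowerSeries ι k) := Ideal.span (Set.range .X)
  let _ : Algebra (MvPowerSeries ι k) R := φ.toRingHom.toAlgebra
  have : IsScalarTower k (MvPowerSeries ι k) R := .of_algebraMap_eq' φ.comp_algebraMap.symm
  have hI : I.map (algebraMap _ R) = Ideal.span (Set.range fun i => φ (.X i)) := by
    rw [Ideal.map_span, ← Set.range_comp]
    rfl
  have : IsHausdorff I R := .of_map (hI.trans_le hφ.1.2)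
  have : Module.Finite (MvPowerSeries ι k) (ResidueField R) := .of_restrictScalars_finite k _ _
  have : Module.Finite (MvPowerSeries ι k) (R ⧸ (I.map (algebraMap _ R)).radical) := by
    rw [hI, radical_eq_maximalIdeal_of_mem_minimalPrimes hφ]
    assumption
  have : Module.Finite (MvPowerSeries ι k) (R ⧸ (I • ⊤ : Submodule (MvPowerSeries ι k) R)) := by
    have := finite_quotient_of_finite_quotient_radical (A := MvPowerSeries ι k)
      (I.map (algebraMap _ R))
    rw [Ideal.smul_top_eq_map]
    exact .equiv (Submodule.Quotient.restrictScalarsEquiv _ (I.map (algebraMap _ R))).symm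
  exact finite_of_finite_quotient_smul_top I

theorem exists_finite_injective_algHom_mvPowerSeries {k R : Type*} [Field k] [CommRing R]
    [IsLocalRing R] [IsNoetherianRing R] [IsAdicComplete (maximalIdeal R) R] [Algebra k R]
    [Module.Finite k (ResidueField R)] :
    ∃ (s : Finset R) (φ : MvPowerSeries s k →ₐ[k] R),
      φ.Finite ∧ Function.Injective φ ∧ s.card = ringKrullDim R := by
  obtain ⟨s, hs, hcard⟩ :=
    Ideal.exists_finset_card_eq_height_of_isNoetherianRing (maximalIdeal R)
  have hdim : (s.card : WithBot ℕ∞) = ringKrullDim R := by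
    rw [← maximalIdeal_height_eq_ringKrullDim, ← hcard]
    rfl
  obtain ⟨φ, hφ⟩ := exists_algHom_mvPowerSeries_X_eq (k := k) (I := maximalIdeal R)
    fun i : s => hs.1.2 (Ideal.subset_span i.2)
  have hfin : φ.Finite := by
    refine finite_mvPowerSeries_of_maximalIdeal_mem_minimalPrimes φ ?_
    simpa only [hφ, Subtype.range_coe_subtype, Finset.setOfPred_mem] using hs
  have : IsDomain (MvPowerSeries s k) := NoZeroDivisors.to_isDomain _
  let _ : Algebra (MvPowerSeries s k) R := φ.toRingHom.toAlgebra
  have : Algebra.IsIntegral (MvPowerSeries s k) R := ⟨hfin.to_isIntegral⟩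
  refine ⟨s, φ, hfin, injective_algebraMap_of_ringKrullDim_le (n := s.card) ?_ hdim.le, hdim⟩
  simpa using ringKrullDim_mvPowerSeries_le s k

end Normalization

/-! ### Existence of a nonzero derivation -/

section Derivations

variable {S A R K : Type*} [CommRing S] [CommRing A] [CommRing R]

open scoped TensorProduct in
theorem exists_derivation_extension_of_formallyEtale [CommRing K] [Algebra S A] [Algebra S K]
    [Algebra A K] [IsScalarTower S A K] [Algebra.FormallyEtale A K] {M : Type*} [AddCommGroup M]
    [Module S M] [Module A M] [Module K M] [IsScalarTower S A M] [IsScalarTower A K M]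
    [IsScalarTower S K M] (d : Derivation S A M) :
    ∃ D : Derivation S K M, ∀ a, D (algebraMap A K a) = d a := by
  let ℓ : K ⊗[A] Ω[A⁄S] →ₗ[K] M := d.liftKaehlerDifferential.liftBaseChange K
  let e := KaehlerDifferential.tensorKaehlerEquivOfFormallyEtale S A K
  refine ⟨(ℓ ∘ₗ e.symm.toLinearMap).compDer (KaehlerDifferential.D S K), fun a => ?_⟩
  simp [ℓ, e, KaehlerDifferential.tensorKaehlerEquivOfFormallyEtale_symm_D_algebraMap]

theorem exists_derivation_ne_zero_of_not_isSeparable {L K : Type*} [Field L] [Field K]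
    [Algebra L K] [Algebra.EssFiniteType L K] (h : ¬Algebra.IsSeparable L K) :
    ∃ D : Derivation L K K, D ≠ 0 := by
  have : Nontrivial (Ω[K⁄L]) := by
    rw [← not_subsingleton_iff_nontrivial]
    exact fun hΩ => h ((Algebra.FormallyUnramified.iff_isSeparable L K).mp ⟨hΩ⟩)
  have : Nontrivial (Module.Dual K (Ω[K⁄L])) := inferInstance
  have : Nontrivial (Derivation L K K) :=
    (KaehlerDifferential.linearMapEquivDerivation L K).toEquiv.symm.nontrivial
  exact exists_ne 0

theorem exists_derivation_algebraMap_eq [CommRing K] [Algebra S R] [Algebra S K] [Algebra R K]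
    [IsScalarTower S R K] (hinj : Function.Injective (algebraMap R K)) (d : Derivation S R K)
    (hd : ∀ r, d r ∈ (algebraMap R K).range) :
    ∃ D : Derivation S R R, ∀ r, algebraMap R K (D r) = d r := by
  choose F hF using hd
  let F' : R →ₗ[S] R :=
    { toFun := F
      map_add' x y := hinj (by simp only [hF, map_add])
      map_smul' c x := hinj (by
        rw [hF, Derivation.map_smul, RingHom.id_apply, Algebra.smul_def c (F x), map_mul, hF,
          ← IsScalarTower.algebraMap_apply, Algebra.smul_def]) }
  refine ⟨Derivation.mk' F' fun x y => hinj ?_, hF⟩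
  simp only [F', LinearMap.coe_mk, AddHom.coe_mk, hF, Derivation.leibniz, map_add, smul_eq_mul,
    map_mul, Algebra.smul_def]

theorem exists_mul_derivation_mem_range [CommRing K] [Algebra S R] [Algebra S K] [Algebra A R]
    [Module.Finite A R] [Algebra R K] (M : Submonoid R) [IsLocalization M K]
    (d : Derivation S R K) (hd : ∀ a, d (algebraMap A R a) ∈ (algebraMap R K).range) :
    ∃ g ∈ M, ∀ r, algebraMap R K g * d r ∈ (algebraMap R K).range := by
  classical
  obtain ⟨T, hT⟩ := Module.Finite.fg_top (R := A) (M := R)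
  obtain ⟨⟨g, hgM⟩, hg⟩ := IsLocalization.exist_integer_multiples_of_finset M (T.image d)
  refine ⟨g, hgM, fun r => ?_⟩
  have hr : r ∈ Submodule.span A (T : Set R) := hT ▸ trivial
  induction hr using Submodule.span_induction with
  | mem x hx =>
    rw [← Algebra.smul_def]
    exact hg _ (Finset.mem_image_of_mem d hx)
  | zero => simp
  | add x y _ _ hx hy =>
    rw [map_add, mul_add]
    exact add_mem hx hy
  | smul a x _ hx =>
    have hleibniz : algebraMap R K g * d (a • x) =
        algebraMap R K (algebraMap A R a) * (algebraMap R K g * d x) +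
          algebraMap R K (g * x) * d (algebraMap A R a) := by
      simp only [Algebra.smul_def, Derivation.leibniz, map_mul]
      ring
    rw [hleibniz]
    exact add_mem (mul_mem ⟨_, rfl⟩ hx) (mul_mem ⟨_, rfl⟩ (hd a))

theorem derivation_eq_zero_of_forall_algebraMap [Field K] [Algebra S K] [Algebra R K]
    [IsFractionRing R K] {D : Derivation S K K} (hD : ∀ r, D (algebraMap R K r) = 0) : D = 0 := by
  ext z
  obtain ⟨x, y, -, rfl⟩ := IsFractionRing.div_surjective (A := R) z
  simp [Derivation.leibniz_div, hD]

theorem exists_derivation_ne_zero_of_fractionRing [Algebra S R] [Algebra A R] [Module.Finite A R]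
    [Field K] [Algebra S K] [Algebra R K] [IsScalarTower S R K] [IsFractionRing R K]
    {D : Derivation S K K} (hD : D ≠ 0)
    (hA : ∀ a, D (algebraMap R K (algebraMap A R a)) ∈ (algebraMap R K).range) :
    ∃ D' : Derivation S R R, D' ≠ 0 := by
  let d : Derivation S R K := D.compAlgebraMap R
  obtain ⟨g, hg, hgd⟩ := exists_mul_derivation_mem_range (nonZeroDivisors R) d hA
  obtain ⟨D', hD'⟩ := exists_derivation_algebraMap_eq (IsFractionRing.injective R K)
    (algebraMap R K g • d) hgd
  refine ⟨D', ?_⟩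
  rintro rfl
  refine hD (derivation_eq_zero_of_forall_algebraMap (R := R) fun r => ?_)
  have hgr : algebraMap R K g * d r = 0 := (hD' r).symm.trans (map_zero _)
  exact (mul_eq_zero.mp hgr).resolve_left (IsLocalization.map_units K ⟨g, hg⟩).ne_zero

theorem exists_derivation_ne_zero_of_formallyEtale [Field K] [Algebra S A] [Algebra S R]
    [Algebra S K] [Algebra A R] [Algebra A K] [Algebra R K] [IsScalarTower S A K]
    [IsScalarTower S R K] [IsScalarTower A R K] [Module.Finite A R] [IsFractionRing R K]
    [Algebra.FormallyEtale A K] (hinj : Function.Injective (algebraMap A R))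
    {d : Derivation S A A} (hd : d ≠ 0) : ∃ D : Derivation S R R, D ≠ 0 := by
  have hinjK : Function.Injective (algebraMap A K) := by
    rw [IsScalarTower.algebraMap_eq A R K]
    exact (IsFractionRing.injective R K).comp hinj
  obtain ⟨D, hD⟩ := exists_derivation_extension_of_formallyEtale (K := K)
    ((Algebra.linearMap A K).compDer d)
  replace hD : ∀ a, D (algebraMap A K a) = algebraMap A K (d a) := hD
  refine exists_derivation_ne_zero_of_fractionRing (A := A) (D := D) ?_ fun a => ?_
  · rintro rfl
    refine hd (Derivation.ext fun a => hinjK ?_)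
    rw [← hD, Derivation.zero_apply, Derivation.zero_apply, map_zero]
  · rw [← IsScalarTower.algebraMap_apply, hD, IsScalarTower.algebraMap_apply A R]
    exact ⟨_, rfl⟩

theorem exists_derivation_ne_zero_of_finite [IsDomain A] [IsDomain R] [Algebra S A] [Algebra S R]
    [Algebra A R] [IsScalarTower S A R] [Module.Finite A R]
    (hinj : Function.Injective (algebraMap A R)) {d : Derivation S A A} (hd : d ≠ 0) :
    ∃ D : Derivation S R R, D ≠ 0 := by
  let L := FractionRing A
  let K := FractionRing R
  have : FaithfulSMul A R := (faithfulSMul_iff_algebraMap_injective A R).mpr hinj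
  have : FaithfulSMul A K := .trans A R K
  let _ : Algebra L K := FractionRing.liftAlgebra A K
  have : IsScalarTower A L K := FractionRing.isScalarTower_liftAlgebra A K
  have : IsScalarTower S A K := .to₁₂₄ S A R K
  have : IsScalarTower S L K := .to₁₃₄ S A L K
  have : Algebra.EssFiniteType R K := .of_isLocalization _ (nonZeroDivisors R)
  have : Algebra.EssFiniteType A K := .comp A R K
  have : Algebra.EssFiniteType L K := .of_comp A L K
  by_cases hsep : Algebra.IsSeparable L K
  · have : Algebra.FormallyEtale L K := .of_isSeparable L K
    have : Algebra.FormallyEtale A L := .of_isLocalization (nonZeroDivisors A)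
    have : Algebra.FormallyEtale A K := .comp A L K
    exact exists_derivation_ne_zero_of_formallyEtale (K := K) hinj hd
  · obtain ⟨D, hD⟩ := exists_derivation_ne_zero_of_not_isSeparable hsep
    refine exists_derivation_ne_zero_of_fractionRing (A := A) (D := D.restrictScalars S) ?_
      fun a => ⟨0, ?_⟩
    · exact fun h => hD (Derivation.ext fun z => DFunLike.congr_fun h z)
    · rw [← IsScalarTower.algebraMap_apply, IsScalarTower.algebraMap_apply A L K,
        Derivation.restrictScalars_apply, D.map_algebraMap, map_zero]

open IsLocalRing

variable [IsLocalRing R]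

theorem finite_residueField_of_surjective {k : Type*} [CommRing k]
    [Algebra k R] (h : Function.Surjective ((residue R).comp (algebraMap k R))) :
    Module.Finite k (ResidueField R) :=
  .of_surjective (Algebra.linearMap k (ResidueField R)) h

variable [IsDomain R] [IsNoetherianRing R] [IsAdicComplete (maximalIdeal R) R]

theorem exists_derivation_ne_zero_of_finite_residueField (k : Type*) [Field k] [Algebra k R]
    [Module.Finite k (ResidueField R)] (hdim : 0 < ringKrullDim R) :
    ∃ D : Derivation k R R, D ≠ 0 := by
  obtain ⟨s, φ, hfin, hinj, hs⟩ := exists_finite_injective_algHom_mvPowerSeries (k := k) (R := R)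
  rw [← hs] at hdim
  obtain ⟨i, hi⟩ := Finset.card_pos.mp (by exact_mod_cast hdim)
  let A := MvPowerSeries s k
  have : IsDomain A := NoZeroDivisors.to_isDomain A
  let _ : Algebra A R := φ.toAlgebra
  have : IsScalarTower k A R := .of_algebraMap_eq' φ.comp_algebraMap.symm
  have : Module.Finite A R := hfin
  let d : Derivation k A A := MvPowerSeries.pderiv k (⟨i, hi⟩ : s)
  have hdX : d (MvPowerSeries.X ⟨i, hi⟩) = 1 := MvPowerSeries.pderiv_X_self
  refine exists_derivation_ne_zero_of_finite (d := d) hinj fun hd0 => ?_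
  rw [hd0, Derivation.zero_apply] at hdX
  exact zero_ne_one hdX

theorem exists_derivation_ne_zero_of_isAdicComplete
    (hchar : ringChar R = ringChar (ResidueField R)) (hdim : 0 < ringKrullDim R) :
    ∃ D : Derivation ℤ R R, D ≠ 0 := by
  obtain ⟨σ, hσ⟩ := exists_ringHom_section_residue hchar
  let _ : Algebra (ResidueField R) R := σ.toAlgebra
  have := finite_residueField_of_surjective (k := ResidueField R) (R := R)
    fun a => ⟨a, hσ a⟩
  obtain ⟨D, hD⟩ := exists_derivation_ne_zero_of_finite_residueField (ResidueField R) hdim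
  exact ⟨D.restrictScalars ℤ, fun h => hD (Derivation.ext fun x => DFunLike.congr_fun h x)⟩

end Derivations

theorem mainTheorem8 {R : Type*} [CommRing R] [IsDomain R] [IsLocalRing R] [IsNoetherianRing R]
    [IsAdicComplete (IsLocalRing.maximalIdeal R) R] [IsIntegrallyClosed R]
    (hchar : ringChar R = ringChar (IsLocalRing.ResidueField R))
    (hdim : 2 ≤ ringKrullDim R)
    (r : ℕ) (q : Fin r → Ideal R) (hprime : ∀ i, (q i).IsPrime)
    (hheight : ∀ i, (q i).height = 1) :
    ∃ x : ℕ → R,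
      Function.Injective (fun n => Ideal.span ({x n} : Set R)) ∧
      ∀ n, x n ≠ 0 ∧ (∀ i, x n ∉ q i) ∧ IsReduced (R ⧸ Ideal.span ({x n} : Set R)) := by
  have hm : 2 ≤ (IsLocalRing.maximalIdeal R).height := by
    rw [← IsLocalRing.maximalIdeal_height_eq_ringKrullDim] at hdim
    exact WithBot.coe_le_coe.mp hdim
  obtain ⟨D, hD⟩ := exists_derivation_ne_zero_of_isAdicComplete hchar
    (lt_of_lt_of_le (by decide) hdim)
  obtain ⟨a, ha, b, hb, hab, hW⟩ := exists_coprimeInCodimOne_derivationWronskian_ne_zero hD hm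
  obtain ⟨c, hDc, hc⟩ := exists_derivation_constants_injective_mk hchar D hb
  have hunit : ∀ n, ¬IsUnit (a - c n * b) := fun n =>
    (IsLocalRing.mem_maximalIdeal _).mp (Ideal.sub_mem _ ha (Ideal.mul_mem_left _ _ hb))
  simpa only [Set.forall_mem_range] using
    hab.exists_seq_isReduced_quotient_span_singleton hW hDc hc hunit (Set.finite_range q)
      (Set.forall_mem_range.mpr hprime) (Set.forall_mem_range.mpr fun i => (hheight i).le)
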